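/- Let $m,n\ge 2$ be integers, and let $f$ and $g$ be meromorphic functions on $\mathbb{C}$ with $f^m+g^n=1$. Then $f$ and $g$ are both constant if and only if $\mathcal{Z}(f')=\mathcal{Z}(g')$ counting multiplicity, that is, if and only if every $z\in\mathbb{C}$ is a zero of $f'$ and a zero of $g'$ with the same multiplicity. (Here a point that is not a zero has multiplicity $0$, poles included, and every point is a zero of infinite multiplicity of the function that vanishes identically.) -/

import Mathlib

open Filter

/-- The multiplicity of `z` as a zero of the meromorphic function `h`: the order of `h` at `z` if
this is positive, and `0` if `h` is finite and nonzero at `z` or has a pole there. It is `⊤` if `h`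
vanishes identically near `z`. It depends only on the values of `h` in punctured neighbourhoods of
`z`, so values of `h` at poles and removable singularities play no role. -/
noncomputable def zeroMultiplicity (h : ℂ → ℂ) (z : ℂ) : WithTop ℤ :=
  max (meromorphicOrderAt h z) 0

/-- `𝒵(h) = 𝒵(k)` counting multiplicity: every point of the plane has the same multiplicity as a
zero of `h` and as a zero of `k`. -/
def SameZerosCountingMultiplicity (h k : ℂ → ℂ) : Prop :=
  ∀ z : ℂ, zeroMultiplicity h z = zeroMultiplicity k z

/-- `f` is constant as a meromorphic function on the plane: it agrees with a constant off a closed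
discrete set (where the representative `f` may take arbitrary values). -/
def IsConstantMeromorphic (f : ℂ → ℂ) : Prop :=
  ∃ c : ℂ, f =ᶠ[codiscrete ℂ] fun _ => c

/-! Suppose `f` has a zero of finite order `k` at `z`. Then `g ^ n` tends to 1 there, so `g` is
finite and nonzero. In `m f^(m-1) f' = -n g^(n-1) g'` the left side has order `m k - 1`, and the
right side has the order of `g'`. Shared zeros of the derivatives make that order `k - 1`, which is
impossible for `m ≥ 2`. By symmetry neither function has a zero. Hence `1/f` is entire. Where
`(1/f)^m = 1`, `g` would vanish, so `1/f` omits all `m`-th roots of unity. There are at least two of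
these, and little Picard makes `f` constant; likewise `g`. Picard itself follows from a weak Bloch
theorem by taking `cosh`-logarithms twice. -/

/-! ### Little Picard theorem -/

open Topology Metric in
/-- A weak form of **Bloch's theorem**: the range of an entire function with nonzero derivative at
some point contains arbitrarily large balls. -/
theorem Complex.exists_ball_subset_range {f : ℂ → ℂ} (hf : Differentiable ℂ f) {a : ℂ}
    (ha : deriv f a ≠ 0) {r : ℝ} (hr : 0 < r) : ∃ c, ball c r ⊆ Set.range f := by
  have ha' : 0 < ‖deriv f a‖ := norm_pos_iff.mpr ha
  have hdf : Differentiable ℂ (deriv f) := fun z =>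
    (hf.analyticAt z).deriv.differentiableAt
  -- 48 = 2 · 2 · 12: one 2 from halving the distance to the boundary, one from the open mapping
  -- lemma at the end, and 12 from `hlower`.
  set R : ℝ := 48 * r / ‖deriv f a‖ with hR
  have hRpos : 0 < R := by positivity
  have hRa : ‖deriv f a‖ * R = 48 * r := by rw [hR]; field_simp
  -- Maximising this weighted derivative gives a point `p` around which `f'` at most doubles in
  -- norm, on a disc of comparable radius.
  obtain ⟨p, hp, hmax⟩ := (isCompact_closedBall a R).exists_isMaxOn
    (f := fun z => ‖deriv f z‖ * (R - dist z a)) ⟨a, mem_closedBall_self hRpos.le⟩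
    ((hdf.continuous.norm.mul (by fun_prop)).continuousOn)
  have hpa : 48 * r ≤ ‖deriv f p‖ * (R - dist p a) := by
    have := hmax (mem_closedBall_self hRpos.le)
    simpa [hRa] using this
  have hpR : 0 < R - dist p a :=
    pos_of_mul_pos_right (lt_of_lt_of_le (by positivity) hpa) (norm_nonneg _)
  have hp' : 0 < ‖deriv f p‖ :=
    pos_of_mul_pos_left (lt_of_lt_of_le (by positivity) hpa) hpR.le
  set s : ℝ := (R - dist p a) / 2 with hs
  have hspos : 0 < s := by positivity
  have hbound : ∀ z ∈ ball p s, ‖deriv f z‖ ≤ 2 * ‖deriv f p‖ := by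
    intro z hz
    rw [mem_ball] at hz
    have h1 : s ≤ R - dist z a := by
      have := dist_triangle z p a
      linarith
    have h2 : ‖deriv f z‖ * (R - dist z a) ≤ ‖deriv f p‖ * (R - dist p a) :=
      hmax (mem_closedBall.mpr (by linarith))
    have h3 : ‖deriv f z‖ * s ≤ ‖deriv f p‖ * (2 * s) :=
      (mul_le_mul_of_nonneg_left h1 (norm_nonneg _)).trans (h2.trans_eq (by rw [hs]; ring))
    exact le_of_mul_le_mul_right (h3.trans_eq (by ring)) hspos
  have hmaps : Set.MapsTo (deriv f) (ball p s) (closedBall (deriv f p) (3 * ‖deriv f p‖)) := by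
    intro z hz
    rw [mem_closedBall, dist_eq_norm]
    linarith [norm_sub_le (deriv f z) (deriv f p), hbound z hz]
  -- Schwarz lemma for `f'` on `ball p s`; near `p`, `f` is then close to its linear part.
  have hclose : ∀ z ∈ closedBall p (s / 6), ‖deriv f z - deriv f p‖ ≤ ‖deriv f p‖ / 2 := by
    intro z hz
    rw [mem_closedBall] at hz
    have h := Complex.dist_le_div_mul_dist_of_mapsTo_ball hdf.differentiableOn hmaps
      (mem_ball.mpr (by linarith : dist z p < s))
    rw [← dist_eq_norm]
    calc dist (deriv f z) (deriv f p) ≤ 3 * ‖deriv f p‖ / s * dist z p := h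
      _ ≤ 3 * ‖deriv f p‖ / s * (s / 6) := by gcongr
      _ = ‖deriv f p‖ / 2 := by field_simp; norm_num
  have hlower : ∀ z ∈ sphere p (s / 6), ‖deriv f p‖ * s / 12 ≤ ‖f z - f p‖ := by
    intro z hz
    have hder : ∀ w, HasDerivAt (fun w => f w - deriv f p * w) (deriv f w - deriv f p) w :=
      fun w => by simpa using
        (hf w).hasDerivAt.fun_sub ((hasDerivAt_id w).const_mul (deriv f p))
    have h := (convex_closedBall p (s / 6)).norm_image_sub_le_of_norm_hasDerivWithin_le
      (fun w _ => (hder w).hasDerivWithinAt) hclose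
      (mem_closedBall_self (by positivity)) (sphere_subset_closedBall hz)
    have hzp : ‖z - p‖ = s / 6 := by simpa [dist_eq_norm] using hz
    have h2 : deriv f p * (z - p) =
      (f z - f p) - ((f z - deriv f p * z) - (f p - deriv f p * p)) := by ring
    have h3 := norm_sub_le (f z - f p) ((f z - deriv f p * z) - (f p - deriv f p * p))
    rw [← h2, norm_mul, hzp] at h3
    rw [hzp] at h
    linarith
  have hne : ∃ᶠ z in 𝓝 p, f z ≠ f p :=
    (((hf p).hasDerivAt.eventually_ne (norm_pos_iff.mp hp')).frequently).filter_mono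
      nhdsWithin_le_nhds
  have hsub := DiffContOnCl.ball_subset_image_closedBall (f := f) hf.diffContOnCl
    (by positivity) hlower hne
  refine ⟨f p, (ball_subset_ball ?_).trans (hsub.trans (Set.image_subset_range _ _))⟩
  rw [hs]
  linarith

theorem Complex.exists_eq_exp {f : ℂ → ℂ} (hf : Differentiable ℂ f) (h0 : ∀ z, f z ≠ 0) :
    ∃ g : ℂ → ℂ, Differentiable ℂ g ∧ ∀ z, f z = Complex.exp (g z) := by
  have hdf : Differentiable ℂ (deriv f) := fun z =>
    (hf.analyticAt z).deriv.differentiableAt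
  obtain ⟨g, hg0, hg⟩ := (hdf.div hf h0).isExactOn_univ.with_val_at 0 (Complex.log (f 0))
  have hg' : ∀ z, HasDerivAt g (deriv f z / f z) z := fun z => hg z trivial
  refine ⟨g, fun z => (hg' z).differentiableAt, fun z => ?_⟩
  have hder : ∀ z, HasDerivAt (fun z => f z * Complex.exp (-g z)) 0 z := fun z => by
    have h := (hf z).hasDerivAt.mul (hg' z).neg.cexp
    refine h.congr_deriv ?_
    linear_combination (-Complex.exp (-g z)) * mul_div_cancel₀ (deriv f z) (h0 z)
  have hc := is_const_of_deriv_eq_zero (fun z => (hder z).differentiableAt)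
    (fun z => (hder z).deriv) z 0
  simp only [hg0, Complex.exp_neg, Complex.exp_log (h0 0)] at hc
  rw [mul_inv_cancel₀ (h0 0)] at hc
  exact (mul_inv_eq_one₀ (Complex.exp_ne_zero _)).mp hc

/-- `f ^ 2 - 1` has an entire square root `s`, and `(f + s) * (f - s) = 1`. So `f + s = exp g`, and
`f` is the mean of `exp g` and `exp (-g)`. -/
theorem Complex.exists_eq_cosh {f : ℂ → ℂ} (hf : Differentiable ℂ f) (h1 : ∀ z, f z ≠ 1)
    (h2 : ∀ z, f z ≠ -1) :
    ∃ g : ℂ → ℂ, Differentiable ℂ g ∧ ∀ z, f z = Complex.cosh (g z) := by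
  obtain ⟨l, hl, hfl⟩ := Complex.exists_eq_exp (f := fun z => f z ^ 2 - 1) (by fun_prop)
    (fun z h => by
      rcases mul_self_eq_one_iff.mp (by linear_combination h) with h | h
      exacts [h1 z h, h2 z h])
  have hprod : ∀ z, (f z + Complex.exp (l z / 2)) * (f z - Complex.exp (l z / 2)) = 1 := fun z => by
    have : Complex.exp (l z / 2) ^ 2 = f z ^ 2 - 1 := by
      rw [hfl, ← Complex.exp_nat_mul]
      congr 1
      push_cast
      ring
    linear_combination -this
  obtain ⟨g, hg, hfg⟩ := Complex.exists_eq_exp (f := fun z => f z + Complex.exp (l z / 2))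
    (by fun_prop) (fun z h => by simpa [h] using hprod z)
  refine ⟨g, hg, fun z => ?_⟩
  have h : Complex.exp (-g z) = f z - Complex.exp (l z / 2) := by
    rw [Complex.exp_neg, ← hfg]
    exact inv_eq_of_mul_eq_one_right (hprod z)
  rw [Complex.cosh, h, ← hfg]
  ring

theorem Real.exists_cosh_eq_intCast (x : ℝ) :
    ∃ t : ℝ, |t - x| ≤ 2 ∧ ∃ n : ℤ, Real.cosh t = n := by
  have h2 : 2 ≤ Real.cosh 2 := by
    have h := Real.quadratic_le_exp_of_nonneg (x := 2) (by norm_num)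
    rw [Real.cosh_eq]
    linarith [Real.exp_pos (-2)]
  have hstep : Real.cosh |x| + 1 ≤ Real.cosh (|x| + 2) := by
    rw [Real.cosh_add]
    have h1 := Real.one_le_cosh |x|
    have h3 : 0 ≤ Real.sinh |x| * Real.sinh 2 :=
      mul_nonneg (Real.sinh_nonneg_iff.mpr (abs_nonneg x)) (Real.sinh_nonneg_iff.mpr (by norm_num))
    nlinarith
  obtain ⟨t, ⟨ht1, ht2⟩, ht⟩ := intermediate_value_Icc (by linarith : |x| ≤ |x| + 2)
    Real.continuous_cosh.continuousOn
    (⟨Int.le_ceil _, (Int.ceil_lt_add_one _).le.trans hstep⟩ :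
      ((⌈Real.cosh |x|⌉ : ℤ) : ℝ) ∈ Set.Icc (Real.cosh |x|) (Real.cosh (|x| + 2)))
  rcases le_total 0 x with hx | hx
  · rw [abs_of_nonneg hx] at ht1 ht2
    exact ⟨t, abs_le.mpr ⟨by linarith, by linarith⟩, _, ht⟩
  · rw [abs_of_nonpos hx] at ht1 ht2
    exact ⟨-t, abs_le.mpr ⟨by linarith, by linarith⟩, _, (Real.cosh_neg t).trans ht⟩

/-- The error is at most 2 in the real part and π in the imaginary part, by the `2πi`-periodicity of
`cosh`. -/
theorem Complex.exists_cosh_eq_intCast (c : ℂ) :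
    ∃ w : ℂ, dist w c < 7 ∧ ∃ n : ℤ, Complex.cosh w = n := by
  obtain ⟨t, ht, n, hn⟩ := Real.exists_cosh_eq_intCast c.re
  set k : ℤ := round (c.im / (2 * Real.pi)) with hk
  have hpi := Real.pi_pos
  refine ⟨t + k * (2 * Real.pi * Complex.I), ?_, n, ?_⟩
  · have him : |k * (2 * Real.pi) - c.im| ≤ Real.pi := by
      have h := abs_sub_round (c.im / (2 * Real.pi))
      rw [← hk, abs_sub_comm] at h
      have h' : (k : ℝ) * (2 * Real.pi) - c.im =
          (k - c.im / (2 * Real.pi)) * (2 * Real.pi) := by field_simp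
      rw [h', abs_mul, abs_of_pos (by positivity : 0 < 2 * Real.pi)]
      calc _ ≤ 1 / 2 * (2 * Real.pi) := by gcongr
        _ = _ := by ring
    rw [dist_eq_norm]
    refine (Complex.norm_le_abs_re_add_abs_im _).trans_lt ?_
    simp only [Complex.sub_re, Complex.add_re, Complex.ofReal_re, Complex.mul_re,
      Complex.intCast_re, Complex.re_ofNat, Complex.im_ofNat, Complex.ofReal_im, Complex.I_re,
      Complex.I_im, Complex.mul_im, Complex.intCast_im, Complex.sub_im, Complex.add_im]
    ring_nf at him ht ⊢
    linarith [Real.pi_lt_four]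
  · rw [Complex.cosh, neg_add, Complex.exp_add, Complex.exp_add, ← neg_mul, ← Int.cast_neg,
      Complex.exp_int_mul_two_pi_mul_I, Complex.exp_int_mul_two_pi_mul_I, mul_one, mul_one,
      ← Complex.cosh, ← Complex.ofReal_cosh, hn, Complex.ofReal_intCast]

/-- **Little Picard theorem**: an entire function that omits two values is constant. -/
theorem Complex.apply_eq_apply_of_forall_ne {f : ℂ → ℂ} (hf : Differentiable ℂ f) {a b : ℂ}
    (hab : a ≠ b) (ha : ∀ z, f z ≠ a) (hb : ∀ z, f z ≠ b) (z w : ℂ) : f z = f w := by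
  have hba : b - a ≠ 0 := sub_ne_zero.mpr hab.symm
  obtain ⟨H, hH, hfH⟩ := Complex.exists_eq_cosh
    (f := fun z => (2 * f z - a - b) / (b - a)) (by fun_prop)
    (fun z h => hb z <| by
      rw [div_eq_one_iff_eq hba] at h
      linear_combination h / 2)
    (fun z h => ha z <| by
      rw [div_eq_iff hba] at h
      linear_combination h / 2)
  have hpi : (Real.pi * Complex.I : ℂ) ≠ 0 := by simp [Real.pi_ne_zero]
  -- At integer multiples of `πi`, `cosh` takes the values ±1, which the normalised `f` omits.
  have homit : ∀ z, ∀ n : ℤ, H z / (Real.pi * Complex.I) ≠ n := by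
    intro z n h
    rw [div_eq_iff hpi] at h
    have h1 := hfH z
    rw [h, ← mul_assoc, Complex.cosh_mul_I] at h1
    have hcos : Complex.cos (n * Real.pi) = 1 ∨ Complex.cos (n * Real.pi) = -1 := by
      have hsin : Complex.sin (n * Real.pi) = 0 := Complex.sin_int_mul_pi n
      have := Complex.sin_sq_add_cos_sq (n * Real.pi)
      rw [hsin] at this
      exact mul_self_eq_one_iff.mp (by linear_combination this)
    rcases hcos with hc | hc
    · rw [hc, div_eq_one_iff_eq hba] at h1
      exact hb z (by linear_combination h1 / 2)
    · rw [hc, div_eq_iff hba] at h1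
      exact ha z (by linear_combination h1 / 2)
  obtain ⟨K, hK, hHK⟩ := Complex.exists_eq_cosh
    (f := fun z => H z / (Real.pi * Complex.I)) (by fun_prop)
    (fun z => by simpa using homit z 1) (fun z => by simpa using homit z (-1))
  -- `cosh ∘ K` omits every integer, so by the previous lemma the range of `K` contains no disc of
  -- radius 7; Bloch then forces `K' = 0`.
  have hK' : ∀ z, deriv K z = 0 := by
    by_contra! h
    obtain ⟨p, hp⟩ := h
    obtain ⟨c, hc⟩ := Complex.exists_ball_subset_range hK hp (r := 7) (by norm_num)
    obtain ⟨w, hw, n, hn⟩ := Complex.exists_cosh_eq_intCast c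
    obtain ⟨z, rfl⟩ := hc (Metric.mem_ball.mpr hw)
    exact homit z n ((hHK z).trans hn)
  have hKc := is_const_of_deriv_eq_zero hK hK' z w
  have hHc : H z = H w := by
    have h := (hHK z).trans ((congrArg _ hKc).trans (hHK w).symm)
    exact (div_left_inj' hpi).mp h
  have h := (hfH z).trans ((congrArg _ hHc).trans (hfH w).symm)
  have h' := (div_left_inj' hba).mp h
  linear_combination h' / 2

/-! ### Orders of a meromorphic function and of its derivative -/

open Topology

theorem eventually_codiscrete_iff {X : Type*} [TopologicalSpace X] {p : X → Prop} :
    (∀ᶠ x in codiscrete X, p x) ↔ ∀ x, ∀ᶠ y in 𝓝[≠] x, p y := by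
  rw [Filter.Eventually, mem_codiscrete]
  simp [disjoint_principal_right, Filter.Eventually]

theorem meromorphicOrderAt_deriv_nonneg {f : ℂ → ℂ} {z : ℂ} (hf : MeromorphicAt f z)
    (h : 0 ≤ meromorphicOrderAt f z) : 0 ≤ meromorphicOrderAt (deriv f) z := by
  rw [meromorphicOrderAt_congr hf.eq_nhdsNE_toMeromorphicNFAt.nhdsNE_deriv]
  exact (hf.meromorphicOrderAt_nonneg_iff_analyticAt_toMeromorphicNFAt.mp
    h).deriv.meromorphicOrderAt_nonneg

theorem meromorphicOrderAt_eq_zero_or_top_of_deriv_eq_top {f : ℂ → ℂ} {z : ℂ}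
    (h : meromorphicOrderAt (deriv f) z = ⊤) :
    meromorphicOrderAt f z = 0 ∨ meromorphicOrderAt f z = ⊤ := by
  by_contra! hne
  obtain ⟨k, hk⟩ := WithTop.ne_top_iff_exists.mp hne.2
  have hk0 : (k : ℂ) ≠ 0 := by
    rintro h0
    rw [Int.cast_eq_zero.mp h0] at hk
    exact hne.1 hk.symm
  rw [meromorphicOrderAt_deriv_eq_sub_one hk0 hk.symm] at h
  exact WithTop.coe_ne_top h

/-- Take `c` to be the limit of `f` at `z`: then `f - c` has positive order, and a finite nonzero
order would give its derivative finite order. -/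
theorem exists_meromorphicOrderAt_sub_const_eq_top {f : ℂ → ℂ} {z : ℂ} (hf : MeromorphicAt f z)
    (h : meromorphicOrderAt (deriv f) z = ⊤) :
    ∃ c, meromorphicOrderAt (fun w => f w - c) z = ⊤ := by
  have h0 : 0 ≤ meromorphicOrderAt f z := by
    rcases meromorphicOrderAt_eq_zero_or_top_of_deriv_eq_top h with h | h <;> simp [h]
  obtain ⟨c, hc⟩ := tendsto_nhds_of_meromorphicOrderAt_nonneg hf h0
  refine ⟨c, (meromorphicOrderAt_eq_zero_or_top_of_deriv_eq_top ?_).resolve_left ?_⟩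
  · rwa [show deriv (fun w => f w - c) = deriv f by ext; simp]
  · refine ((tendsto_zero_iff_meromorphicOrderAt_pos (by fun_prop)).mp ?_).ne'
    simpa using hc.sub_const c

theorem IsConstantMeromorphic.meromorphicOrderAt_deriv {f : ℂ → ℂ} (hf : IsConstantMeromorphic f)
    (z : ℂ) : meromorphicOrderAt (deriv f) z = ⊤ := by
  obtain ⟨c, hc⟩ := hf
  have h : f =ᶠ[𝓝[≠] z] fun _ => c := eventually_codiscrete_iff.mp hc z
  rw [meromorphicOrderAt_eq_top_iff]
  filter_upwards [h.nhdsNE_deriv] with w hw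
  simpa using hw

theorem Meromorphic.isConstantMeromorphic {f : ℂ → ℂ} (hf : Meromorphic f) {z : ℂ}
    (h : meromorphicOrderAt (deriv f) z = ⊤) : IsConstantMeromorphic f := by
  obtain ⟨c, hc⟩ := exists_meromorphicOrderAt_sub_const_eq_top (hf z) h
  refine ⟨c, eventually_codiscrete_iff.mpr fun w => ?_⟩
  have hfc : Meromorphic fun w => f w - c := by fun_prop
  have hw : meromorphicOrderAt (fun w => f w - c) w = ⊤ := by
    by_contra hw
    exact (meromorphicOn_univ.mpr hfc).meromorphicOrderAt_ne_top_of_isPreconnected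
      isPreconnected_univ (Set.mem_univ w) (Set.mem_univ z) hw hc
  filter_upwards [meromorphicOrderAt_eq_top_iff.mp hw] with x hx
  exact sub_eq_zero.mp hx

/-! ### The equation `f ^ m + g ^ n = 1` -/

/-- If `f ^ m + g ^ n = 1` with `m ≥ 2` and the derivatives of `f` and `g` vanish at `z` to the same
finite order, then `f` does not vanish at `z`. -/
theorem meromorphicOrderAt_nonpos_of_pow_add_pow_eq_one {m n : ℕ} (hm : 2 ≤ m) (hn : n ≠ 0)
    {f g : ℂ → ℂ} {z : ℂ} (hf : MeromorphicAt f z) (hg : MeromorphicAt g z)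
    (hfg : ∀ᶠ w in 𝓝[≠] z, f w ^ m + g w ^ n = 1)
    (hz : zeroMultiplicity (deriv f) z = zeroMultiplicity (deriv g) z)
    (hf' : meromorphicOrderAt (deriv f) z ≠ ⊤) : meromorphicOrderAt f z ≤ 0 := by
  by_contra! hpos
  have hf0 := tendsto_zero_of_meromorphicOrderAt_pos hpos
  have hgn : Tendsto (g ^ n) (𝓝[≠] z) (𝓝 1) := by
    have h : Tendsto (fun w => 1 - f w ^ m) (𝓝[≠] z) (𝓝 1) := by
      simpa [show m ≠ 0 by lia] using (hf0.pow m).const_sub 1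
    refine h.congr' ?_
    filter_upwards [hfg] with w hw
    rw [Pi.pow_apply, ← hw]
    ring
  have hg0 : meromorphicOrderAt g z = 0 := by
    have h := (tendsto_ne_zero_iff_meromorphicOrderAt_eq_zero (hg.pow n)).mp
      ⟨1, one_ne_zero, hgn⟩
    rw [meromorphicOrderAt_pow hg] at h
    exact (mul_eq_zero.mp h).resolve_left (by exact_mod_cast hn)
  obtain ⟨c, hc0, hc⟩ := tendsto_ne_zero_of_meromorphicOrderAt_eq_zero hg hg0
  -- Neither `f` nor `g` has a pole at `z`, so the truncation at 0 is harmless and the derivatives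
  -- have equal orders.
  rw [zeroMultiplicity, zeroMultiplicity, max_eq_left (meromorphicOrderAt_deriv_nonneg hf hpos.le),
    max_eq_left (meromorphicOrderAt_deriv_nonneg hg hg0.ge)] at hz
  have hft : meromorphicOrderAt f z ≠ ⊤ := by
    intro h
    refine hf' (meromorphicOrderAt_eq_top_iff.mpr ?_)
    have h0 : f =ᶠ[𝓝[≠] z] fun _ => 0 := meromorphicOrderAt_eq_top_iff.mp h
    filter_upwards [h0.nhdsNE_deriv] with w hw
    simpa using hw
  obtain ⟨k, hk⟩ := WithTop.ne_top_iff_exists.mp hft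
  have hkpos : 0 < k := by
    rw [← hk] at hpos
    exact_mod_cast hpos
  have hmk : meromorphicOrderAt (f ^ m) z = ((m * k : ℤ) : WithTop ℤ) := by
    rw [meromorphicOrderAt_pow hf, ← hk]
    rfl
  have hmkpos : 0 < (m : ℤ) * k := by positivity
  have hleft := meromorphicOrderAt_deriv_eq_sub_one (𝕜 := ℂ) (Int.cast_ne_zero.mpr hmkpos.ne') hmk
  have hfder := meromorphicOrderAt_deriv_eq_sub_one (𝕜 := ℂ) (Int.cast_ne_zero.mpr hkpos.ne')
    hk.symm
  have hpow : f ^ m =ᶠ[𝓝[≠] z] fun w => 1 - g w ^ n := by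
    filter_upwards [hfg] with w hw
    rw [Pi.pow_apply, ← hw]
    ring
  have hder : deriv (f ^ m) =ᶠ[𝓝[≠] z] (fun w => -(n * g w ^ (n - 1))) * deriv g := by
    filter_upwards [hpow.nhdsNE_deriv, hg.eventually_analyticAt] with w hw hgw
    rw [hw, deriv_const_sub, deriv_fun_pow hgw.differentiableAt]
    simp
  have hunit : meromorphicOrderAt (fun w => -(n * g w ^ (n - 1))) z = 0 :=
    (tendsto_ne_zero_iff_meromorphicOrderAt_eq_zero (by fun_prop)).mp
      ⟨-(n * c ^ (n - 1)), by simp [hn, hc0], ((hc.pow (n - 1)).const_mul (n : ℂ)).neg⟩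
  rw [meromorphicOrderAt_congr hder, meromorphicOrderAt_mul (by fun_prop) hg.deriv, hunit, zero_add,
    ← hz, hfder] at hleft
  have hkm : k - 1 = m * k - 1 := by exact_mod_cast hleft
  have : (2 : ℤ) ≤ m := by exact_mod_cast hm
  nlinarith

/-- If `f` and `g` are meromorphic in the plane without zeros and `f ^ m + g ^ n = 1` with `m ≥ 2`,
then `f` is constant. -/
theorem Meromorphic.isConstantMeromorphic_of_pow_add_pow_eq_one {m n : ℕ} (hm : 2 ≤ m) (hn : n ≠ 0)
    {f g : ℂ → ℂ} (hf : Meromorphic f) (hg : Meromorphic g)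
    (hfg : ∀ᶠ z in codiscrete ℂ, f z ^ m + g z ^ n = 1)
    (hf0 : ∀ z, meromorphicOrderAt f z ≤ 0) (hg0 : ∀ z, meromorphicOrderAt g z ≤ 0) :
    IsConstantMeromorphic f := by
  have hinv : MeromorphicOn f⁻¹ Set.univ := meromorphicOn_univ.mpr hf.inv
  set u := toMeromorphicNFOn f⁻¹ Set.univ with hu
  have hdiff : Differentiable ℂ u := fun z => by
    refine AnalyticAt.differentiableAt ?_
    rw [← (meromorphicNFOn_toMeromorphicNFOn f⁻¹ Set.univ
      (Set.mem_univ z)).meromorphicOrderAt_nonneg_iff_analyticAt,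
      meromorphicOrderAt_toMeromorphicNFOn hinv (Set.mem_univ z), meromorphicOrderAt_inv]
    have h := hf0 z
    revert h
    cases meromorphicOrderAt f z with
    | top => simp
    | coe k =>
      intro h
      have : k ≤ 0 := by exact_mod_cast h
      exact_mod_cast neg_nonneg.mpr this
  have huf : ∀ z, ∀ᶠ w in 𝓝[≠] z, f w = (u w)⁻¹ := fun z => by
    filter_upwards [hinv.toMeromorphicNFOn_eq_self_on_nhdsNE (Set.mem_univ z)] with w hw
    rw [hu, hw, Pi.inv_apply, inv_inv]
  -- At such a point `g ^ n` would tend to 0, giving `g` a zero.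
  have hroot : ∀ z, u z ^ m ≠ 1 := by
    intro z hz
    have hu0 : u z ≠ 0 := fun h => by simp [h, show m ≠ 0 by lia] at hz
    have hlim : Tendsto (fun w => 1 - (u w)⁻¹ ^ m) (𝓝[≠] z) (𝓝 0) := by
      have h := (((hdiff.continuous.tendsto z).inv₀ hu0).pow m).const_sub 1
      rw [inv_pow, hz, inv_one, sub_self] at h
      exact h.mono_left nhdsWithin_le_nhds
    have hgn : Tendsto (g ^ n) (𝓝[≠] z) (𝓝 0) := by
      refine hlim.congr' ?_
      filter_upwards [huf z, eventually_codiscrete_iff.mp hfg z] with w hw hw'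
      rw [← hw, Pi.pow_apply, ← hw']
      ring
    have hpos := (tendsto_zero_iff_meromorphicOrderAt_pos ((hg z).pow n)).mp hgn
    rw [meromorphicOrderAt_pow (hg z)] at hpos
    have h := hg0 z
    obtain ⟨k, hk⟩ := WithTop.ne_top_iff_exists.mp (ne_top_of_le_ne_top WithTop.zero_ne_top h)
    rw [← hk] at h hpos
    have hk0 : k ≤ 0 := by exact_mod_cast h
    have hnk : 0 < (n : ℤ) * k := by exact_mod_cast hpos
    exact hnk.not_ge (mul_nonpos_of_nonneg_of_nonpos (by positivity) hk0)
  have hζ := Complex.isPrimitiveRoot_exp m (by lia)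
  have hconst := Complex.apply_eq_apply_of_forall_ne hdiff (hζ.ne_one hm).symm
    (fun z h => hroot z (by rw [h, one_pow])) (fun z h => hroot z (by rw [h, hζ.pow_eq_one]))
  refine ⟨(u 0)⁻¹, eventually_codiscrete_iff.mpr fun z => ?_⟩
  filter_upwards [huf z] with w hw
  rw [hw, hconst w 0]

theorem theorem2 (m n : ℕ) (hm : 2 ≤ m) (hn : 2 ≤ n) (f g : ℂ → ℂ)
    (hf : Meromorphic f) (hg : Meromorphic g)
    (hfg : ∀ᶠ z in codiscrete ℂ, f z ^ m + g z ^ n = 1) :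
    (IsConstantMeromorphic f ∧ IsConstantMeromorphic g) ↔
      SameZerosCountingMultiplicity (deriv f) (deriv g) := by
  constructor
  · rintro ⟨hcf, hcg⟩ z
    simp [zeroMultiplicity, hcf.meromorphicOrderAt_deriv z, hcg.meromorphicOrderAt_deriv z]
  intro hzeros
  have htop : ∀ z, meromorphicOrderAt (deriv f) z = ⊤ ↔ meromorphicOrderAt (deriv g) z = ⊤ := by
    intro z
    have h := hzeros z
    simp only [zeroMultiplicity] at h
    constructor <;> intro ht <;> rw [ht] at h
    · simpa using h.symm
    · simpa using h
  have hgf : ∀ᶠ z in codiscrete ℂ, g z ^ n + f z ^ m = 1 := by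
    filter_upwards [hfg] with z hz
    rwa [add_comm]
  -- If one derivative vanishes identically near a point, so does the other, by equality of infinite
  -- multiplicities, and the identity theorem concludes.
  by_cases hex : ∃ z, meromorphicOrderAt (deriv f) z = ⊤
  · obtain ⟨z, hz⟩ := hex
    exact ⟨hf.isConstantMeromorphic hz, hg.isConstantMeromorphic ((htop z).mp hz)⟩
  · push Not at hex
    have hf0 : ∀ z, meromorphicOrderAt f z ≤ 0 := fun z =>
      meromorphicOrderAt_nonpos_of_pow_add_pow_eq_one hm (by lia) (hf z) (hg z)
        (eventually_codiscrete_iff.mp hfg z) (hzeros z) (hex z)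
    have hg0 : ∀ z, meromorphicOrderAt g z ≤ 0 := fun z =>
      meromorphicOrderAt_nonpos_of_pow_add_pow_eq_one hn (by lia) (hg z) (hf z)
        (eventually_codiscrete_iff.mp hgf z) (hzeros z).symm (mt (htop z).mpr (hex z))
    exact ⟨hf.isConstantMeromorphic_of_pow_add_pow_eq_one hm (by lia) hg hfg hf0 hg0,
      hg.isConstantMeromorphic_of_pow_add_pow_eq_one hn (by lia) hf hgf hg0 hf0⟩
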